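/- Let $(\Omega,\mathcal F,\mathbf P)$ be a probability space and let $X=(X_t)_{t\in[0,1]}$ be a real-valued stochastic process on it that is stochastically continuous, i.e. $X_s\to X_t$ in probability as $s\to t$, for every $t\in[0,1]$. Suppose that for some constants $C$, $r>0$ and $p>1$ the inequalities $$\mathbf E\left[|X_t-X_s|^p\wedge|X_t-X_u|^p\right]\le C|u-s|^{1+r},$$ $$\mathbf E\left[|X_0-X_t|^p\right]\le C\,t^r,\qquad \mathbf E\left[|X_1-X_t|^p\right]\le C\,|1-t|^r$$ hold for all $0\le s<t<u\le 1$. Then $X$ has a càdlàg modification: there is a real-valued process $Y=(Y_t)_{t\in[0,1]}$ on $(\Omega,\mathcal F,\mathbf P)$ such that $\mathbf P(X_t=Y_t)=1$ for every $t\in[0,1]$ and every path $t\mapsto Y_t(\omega)$ is right-continuous with finite left limits on $[0,1]$. -/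

import Mathlib

open MeasureTheory Topology

/-- A function `f : [0,1] → ℝ` is càdlàg: it is right-continuous and has a finite left limit at
every point. The neighbourhoods are those of `[0,1]`, so the left limit at `0` and the
right-continuity at `1` are void. -/
def IsCadlag (f : unitInterval → ℝ) : Prop :=
  ∀ t : unitInterval,
    ContinuousWithinAt f (Set.Ici t) t ∧ ∃ l : ℝ, Filter.Tendsto f (𝓝[<] t) (𝓝 l)

/-- `Y` is a modification of `X`: `P (X t = Y t) = 1` for each time `t`. -/
def IsModification {Ω : Type*} [MeasurableSpace Ω] (P : Measure Ω)
    (X Y : unitInterval → Ω → ℝ) : Prop :=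
  ∀ t : unitInterval, ∀ᵐ ω ∂P, X t ω = Y t ω

/-- Stochastic continuity: for every `t`, `X s` tends to `X t` in probability as `s` tends to `t`
in `[0,1]`. -/
def IsStochasticallyContinuous {Ω : Type*} [MeasurableSpace Ω] (P : Measure Ω)
    (X : unitInterval → Ω → ℝ) : Prop :=
  ∀ t : unitInterval, TendstoInMeasure P X (𝓝 t) (X t)

/-! Extend paths to `ℝ` by constants. At dyadic level `n` there are about `2 ^ n` increment triples,
each with moment of order `2 ^ (-n (1 + r))`, so a weighted sum over all levels has finite mean.
Almost surely the two-sided increments at level `n` are then eventually below a summable geometric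
sequence (`hasSmallMinIncrements_of_tsum_gridEnergy_ne_top`). Chaining (`minIncrement_grid_le`)
spreads this smallness to all close dyadic triples. This forces one-sided limits along the dyadics,
and the right limits form a càdlàg path (`HasSmallMinIncrements.exists_cadlag`). Stochastic
continuity identifies this path with `X t` almost surely at each fixed `t`. -/

/-- The smaller of the two increments of `f` from the middle time `t`. -/
noncomputable def minIncrement (f : ℝ → ℝ) (s t u : ℝ) : ℝ := min |f t - f s| |f t - f u|

/-- The dyadic rationals, as a set of real numbers. -/
def dyadics : Set ℝ := {x | ∃ (n : ℕ) (k : ℤ), x = k / 2 ^ n}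

/-- `f` has vanishing two-sided increments along `D`. -/
def HasSmallMinIncrements (f : ℝ → ℝ) (D : Set ℝ) : Prop :=
  ∀ ε > 0, ∃ δ > 0, ∀ s ∈ D, ∀ t ∈ D, ∀ u ∈ D, s < t → t < u → u - s < δ →
    minIncrement f s t u ≤ ε

theorem minIncrement_left_eq (f : ℝ → ℝ) (s u : ℝ) : minIncrement f s s u = 0 := by
  simp [minIncrement]

theorem minIncrement_right_eq (f : ℝ → ℝ) (s u : ℝ) : minIncrement f s u u = 0 := by
  simp [minIncrement]

theorem minIncrement_le_add {f : ℝ → ℝ} {s t u s' t' u' a b : ℝ} (hs : |f s - f s'| ≤ a)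
    (ht : |f t - f t'| ≤ a) (hu : |f u - f u'| ≤ a) (h : minIncrement f s' t' u' ≤ b) :
    minIncrement f s t u ≤ b + 2 * a := by
  unfold minIncrement at *
  rw [abs_le] at hs ht hu
  rcases min_le_iff.1 h with h | h <;> rw [abs_le] at h
  · exact (min_le_left _ _).trans (abs_le.2 ⟨by linarith, by linarith⟩)
  · exact (min_le_right _ _).trans (abs_le.2 ⟨by linarith, by linarith⟩)

/-! ### Chaining through dyadic grids -/

/-- A grid point is close in value to a neighbouring point of the next coarser grid. -/
theorem exists_coarser_gridPoint {f : ℝ → ℝ} {n : ℕ} {a : ℝ} (ha : 0 ≤ a)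
    (h : ∀ k : ℤ, minIncrement f (k / 2 ^ (n + 1)) ((k + 1) / 2 ^ (n + 1))
      ((k + 2) / 2 ^ (n + 1)) ≤ a) (k : ℤ) :
    ∃ l : ℤ, k - 1 ≤ 2 * l ∧ 2 * l ≤ k + 1 ∧ |f (k / 2 ^ (n + 1)) - f (l / 2 ^ n)| ≤ a := by
  have key : ∀ l : ℤ, (l : ℝ) / 2 ^ n = (2 * l) / 2 ^ (n + 1) := fun l => by
    rw [pow_succ]; field_simp
  -- An even `k` is already on the coarse grid; for odd `k` both neighbours are, and the small
  -- minimum selects one of them.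
  rcases Int.even_or_odd' k with ⟨l, rfl | rfl⟩
  · refine ⟨l, by omega, by omega, ?_⟩
    rw [key]
    simpa using ha
  · have h2 := h (2 * l)
    push_cast at h2 ⊢
    rcases min_le_iff.1 h2 with h2 | h2
    · refine ⟨l, by omega, by omega, ?_⟩
      rwa [key]
    · refine ⟨l + 1, by omega, by omega, ?_⟩
      rw [key]
      push_cast
      rwa [show 2 * ((l : ℝ) + 1) = 2 * l + 2 by ring]

/-- Chaining through the dyadic grids of levels `n, …, n + j`. -/
theorem minIncrement_grid_le {f : ℝ → ℝ} {a : ℕ → ℝ} (ha : ∀ n, 0 ≤ a n) {n : ℕ}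
    (h : ∀ m ≥ n, ∀ k : ℤ, minIncrement f (k / 2 ^ m) ((k + 1) / 2 ^ m) ((k + 2) / 2 ^ m) ≤ a m)
    (j : ℕ) : ∀ m x y z : ℤ, m * 2 ^ j ≤ x → x ≤ y → y ≤ z → z ≤ (m + 2) * 2 ^ j →
      minIncrement f (x / 2 ^ (n + j)) (y / 2 ^ (n + j)) (z / 2 ^ (n + j))
        ≤ a n + 2 * ∑ i ∈ Finset.range j, a (n + 1 + i) := by
  induction j with
  | zero =>
    intro m x y z h1 h2 h3 h4
    simp only [pow_zero, mul_one] at h1 h4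
    simp only [add_zero, Finset.range_zero, Finset.sum_empty, mul_zero]
    rcases h2.eq_or_lt with rfl | h2
    · rw [minIncrement_left_eq]; exact ha n
    rcases h3.eq_or_lt with rfl | h3
    · rw [minIncrement_right_eq]; exact ha n
    obtain rfl : x = m := by omega
    obtain rfl : y = x + 1 := by omega
    obtain rfl : z = x + 2 := by omega
    simpa using h n le_rfl x
  | succ j ih =>
    intro m x y z h1 h2 h3 h4
    choose φ hφ₁ hφ₂ hφ using exists_coarser_gridPoint (n := n + j) (ha (n + j + 1))
      (h (n + j + 1) (by omega))
    -- For `k < l`, `2 φ(k) ≤ k + 1 ≤ l ≤ 2 φ(l) + 1`, so `φ(k) ≤ φ(l)` by parity. Coarsening thus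
    -- keeps the order of the triple.
    have hmono : Monotone φ := fun k l hkl => by
      rcases hkl.eq_or_lt with rfl | hkl
      · rfl
      · have := hφ₂ k
        have := hφ₁ l
        omega
    have e1 : m * 2 ^ (j + 1) = 2 * (m * 2 ^ j) := by ring
    have e2 : (m + 2) * 2 ^ (j + 1) = 2 * ((m + 2) * 2 ^ j) := by ring
    rw [e1] at h1
    rw [e2] at h4
    have hx := hφ₁ x
    have hz := hφ₂ z
    have := minIncrement_le_add (hφ x) (hφ y) (hφ z)
      (ih m (φ x) (φ y) (φ z) (by omega) (hmono h2) (hmono h3) (by omega))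
    rw [Finset.sum_range_succ, show n + 1 + j = n + j + 1 by ring]
    rw [← add_assoc]
    linarith

/-- A triple spanning less than one cell of level `n` fits in two adjacent cells, the window of
`minIncrement_grid_le`. The chaining bound is at most twice the tail of `a` from `n`, hence below
`ε`. -/
theorem hasSmallMinIncrements_dyadics {f : ℝ → ℝ} {a : ℕ → ℝ} (ha : ∀ n, 0 ≤ a n)
    (hsum : Summable a)
    (h : ∀ᶠ m in Filter.atTop, ∀ k : ℤ,
      minIncrement f (k / 2 ^ m) ((k + 1) / 2 ^ m) ((k + 2) / 2 ^ m) ≤ a m) :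
    HasSmallMinIncrements f dyadics := by
  intro ε hε
  have htail := (tendsto_sum_nat_add a).eventually (gt_mem_nhds (half_pos hε))
  obtain ⟨n, hn, hn'⟩ := ((Filter.eventually_forall_ge_atTop.2 h).and htail).exists
  refine ⟨1 / 2 ^ n, by positivity, ?_⟩
  rintro s ⟨n₁, k₁, rfl⟩ t ⟨n₂, k₂, rfl⟩ u ⟨n₃, k₃, rfl⟩ hst htu hsu
  have lift : ∀ (m : ℕ) (k : ℤ) (j : ℕ), m ≤ j →
      ∃ l : ℤ, (k : ℝ) / 2 ^ m = l / 2 ^ (n + j) := fun m k j hm => by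
    refine ⟨k * 2 ^ (n + j - m), ?_⟩
    push_cast
    rw [div_eq_div_iff (by positivity) (by positivity), mul_assoc, ← pow_add]
    congr 2
    omega
  obtain ⟨x, hx⟩ := lift n₁ k₁ (n₁ + n₂ + n₃) (by omega)
  obtain ⟨y, hy⟩ := lift n₂ k₂ (n₁ + n₂ + n₃) (by omega)
  obtain ⟨z, hz⟩ := lift n₃ k₃ (n₁ + n₂ + n₃) (by omega)
  generalize n₁ + n₂ + n₃ = j at hx hy hz
  rw [hx, hy] at hst
  rw [hy, hz] at htu
  rw [hx, hz] at hsu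
  rw [hx, hy, hz]
  have hxy : x ≤ y := by
    rw [div_lt_div_iff_of_pos_right (by positivity)] at hst
    exact_mod_cast hst.le
  have hyz : y ≤ z := by
    rw [div_lt_div_iff_of_pos_right (by positivity)] at htu
    exact_mod_cast htu.le
  have hzx : z ≤ x + 2 ^ j := by
    rw [← sub_div, div_lt_div_iff₀ (by positivity) (by positivity), pow_add, one_mul,
      mul_comm, mul_lt_mul_iff_right₀ (by positivity)] at hsu
    have : (z : ℝ) ≤ x + 2 ^ j := by linarith
    exact_mod_cast this
  have hpos : (0 : ℤ) < 2 ^ j := by positivity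
  have h1 := Int.ediv_mul_le x hpos.ne'
  have h2 := Int.lt_ediv_add_one_mul_self x hpos
  have := minIncrement_grid_le ha hn j (x / 2 ^ j) x y z h1 hxy hyz (by linarith)
  have hs' : Summable fun i => a (i + n) := (summable_nat_add_iff n).2 hsum
  have h3 : ∑ i ∈ Finset.range (j + 1), a (i + n) ≤ ∑' i, a (i + n) :=
    hs'.sum_le_tsum _ fun i _ => ha _
  rw [Finset.sum_range_succ'] at h3
  simp only [zero_add] at h3
  have h4 : ∑ i ∈ Finset.range j, a (n + 1 + i) = ∑ i ∈ Finset.range j, a (i + 1 + n) :=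
    Finset.sum_congr rfl fun i _ => by congr 1; ring
  have := ha n
  linarith

/-! ### One-sided limits along a dense set -/

theorem dense_dyadics : Dense dyadics := by
  refine dense_of_exists_between fun a b hab => ?_
  obtain ⟨n, hn⟩ := pow_unbounded_of_one_lt (1 / (b - a)) (one_lt_two (α := ℝ))
  have hb : 0 < b - a := sub_pos.2 hab
  rw [div_lt_iff₀ hb] at hn
  have h1 := Int.lt_floor_add_one (a * 2 ^ n)
  have h2 := Int.floor_le (a * 2 ^ n)
  refine ⟨_, ⟨n, ⌊a * 2 ^ n⌋ + 1, rfl⟩, ?_, ?_⟩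
  · rw [lt_div_iff₀ (by positivity)]
    push_cast
    exact h1
  · rw [div_lt_iff₀ (by positivity)]
    push_cast
    linarith

theorem Dense.nhdsWithin_inter_Ioi_neBot {D : Set ℝ} (hD : Dense D) (x : ℝ) :
    (𝓝[Set.Ioi x ∩ D] x).NeBot := by
  rw [← mem_closure_iff_nhdsWithin_neBot]
  have h := closure_mono (hD.open_subset_closure_inter (isOpen_Ioi (a := x)))
  rw [closure_Ioi, closure_closure] at h
  exact h Set.self_mem_Ici

/-- If an oscillation `ε` persisted, there would be jumps `s < t` and, nearer `x`, `s' < t' < s`.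
Since `f` jumps between `s'` and `t'`, both `f s` and `f t` are within `ε / 3` of `f t'`, which
contradicts the first jump. -/
theorem HasSmallMinIncrements.exists_tendsto_right {f : ℝ → ℝ} {D : Set ℝ}
    (hf : HasSmallMinIncrements f D) (hD : Dense D) (x : ℝ) :
    ∃ l, Filter.Tendsto f (𝓝[Set.Ioi x ∩ D] x) (𝓝 l) := by
  have := hD.nhdsWithin_inter_Ioi_neBot x
  refine cauchy_map_iff_exists_tendsto.1 (Metric.cauchy_iff.2 ⟨Filter.map_neBot, fun ε hε => ?_⟩)
  by_contra! hcon
  obtain ⟨δ, hδ, hmin⟩ := hf (ε / 3) (by positivity)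
  have key : ∀ y > x, ∃ s t, s ∈ D ∧ t ∈ D ∧ x < s ∧ s < t ∧ t < y ∧ ε ≤ |f s - f t| := by
    intro y hy
    obtain ⟨_, ⟨s, hs, rfl⟩, _, ⟨t, ht, rfl⟩, hst⟩ := hcon (f '' (Set.Iio y ∩ (Set.Ioi x ∩ D)))
      (Filter.image_mem_map (Filter.inter_mem
        (mem_nhdsWithin_of_mem_nhds (Iio_mem_nhds hy)) self_mem_nhdsWithin))
    rw [Real.dist_eq] at hst
    rcases lt_trichotomy s t with h | rfl | h
    · exact ⟨s, t, hs.2.2, ht.2.2, hs.2.1, h, ht.1, hst⟩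
    · simp at hst; linarith
    · exact ⟨t, s, ht.2.2, hs.2.2, ht.2.1, h, hs.1, by rwa [abs_sub_comm]⟩
  obtain ⟨s, t, hs, ht, hxs, hst, hty, h1⟩ := key (x + δ) (by linarith)
  obtain ⟨s', t', hs', ht', hxs', hst', hty', h2⟩ := key s hxs
  have h3 := hmin s' hs' t' ht' s hs hst' hty' (by linarith)
  have h4 := hmin s' hs' t' ht' t ht hst' (by linarith) (by linarith)
  unfold minIncrement at h3 h4
  rw [abs_sub_comm] at h2
  have h3' := (min_le_iff.1 h3).resolve_left (by linarith)
  have h4' := (min_le_iff.1 h4).resolve_left (by linarith)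
  rw [abs_le] at h3' h4'
  have : |f s - f t| ≤ 2 * ε / 3 := abs_le.2 ⟨by linarith, by linarith⟩
  linarith

theorem HasSmallMinIncrements.comp_neg {f : ℝ → ℝ} {D : Set ℝ}
    (hf : HasSmallMinIncrements f D) :
    HasSmallMinIncrements (fun x => f (-x)) (Neg.neg ⁻¹' D) := by
  intro ε hε
  obtain ⟨δ, hδ, h⟩ := hf ε hε
  refine ⟨δ, hδ, fun s hs t ht u hu hst htu hsu => ?_⟩
  have := h (-u) hu (-t) ht (-s) hs (by linarith) (by linarith) (by linarith)
  rwa [minIncrement, min_comm] at this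

theorem HasSmallMinIncrements.exists_tendsto_left {f : ℝ → ℝ} {D : Set ℝ}
    (hf : HasSmallMinIncrements f D) (hD : Dense D) (x : ℝ) :
    ∃ l, Filter.Tendsto f (𝓝[Set.Iio x ∩ D] x) (𝓝 l) := by
  have hD' : Dense (Neg.neg ⁻¹' D) := hD.preimage (Homeomorph.neg ℝ).isOpenMap
  obtain ⟨l, hl⟩ := hf.comp_neg.exists_tendsto_right hD' (-x)
  refine ⟨l, ?_⟩
  have hneg : Filter.Tendsto Neg.neg (𝓝[Set.Iio x ∩ D] x)
      (𝓝[Set.Ioi (-x) ∩ Neg.neg ⁻¹' D] (-x)) :=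
    continuous_neg.continuousWithinAt.tendsto_nhdsWithin fun y hy => by
      simpa using hy
  simpa [Function.comp_def] using hl.comp hneg

/-- The right limits of `f` along `D` form a function which is right-continuous with left
limits. -/
theorem HasSmallMinIncrements.exists_cadlag {f : ℝ → ℝ} {D : Set ℝ}
    (hf : HasSmallMinIncrements f D) (hD : Dense D) :
    ∃ g : ℝ → ℝ, (∀ x, Filter.Tendsto f (𝓝[Set.Ioi x ∩ D] x) (𝓝 (g x))) ∧
      (∀ x, ContinuousWithinAt g (Set.Ici x) x) ∧
      ∀ x, ∃ l, Filter.Tendsto g (𝓝[<] x) (𝓝 l) := by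
  choose g hg using fun x => hf.exists_tendsto_right hD x
  -- `g y` is a limit of `f` along points of `D` that eventually lie in the open `U`, so closed
  -- bounds pass to it.
  have hclose : ∀ {U : Set ℝ} {l ε : ℝ}, IsOpen U → (∀ y ∈ U ∩ D, dist (f y) l ≤ ε) →
      ∀ y ∈ U, dist (g y) l ≤ ε := by
    intro U l ε hU h y hy
    have := hD.nhdsWithin_inter_Ioi_neBot y
    refine le_of_tendsto ((hg y).dist tendsto_const_nhds) ?_
    filter_upwards [mem_nhdsWithin_of_mem_nhds (hU.mem_nhds hy), self_mem_nhdsWithin] with z h1 h2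
    exact h z ⟨h1, h2.2⟩
  have main : ∀ {V : Set ℝ} {x l : ℝ}, IsOpen V →
      Filter.Tendsto f (𝓝[V ∩ D] x) (𝓝 l) → Filter.Tendsto g (𝓝[V] x) (𝓝 l) := by
    intro V x l hV h
    rw [Metric.tendsto_nhds] at h ⊢
    intro ε hε
    obtain ⟨U, hU, hxU, hUV⟩ := mem_nhdsWithin.1 (h (ε / 2) (half_pos hε))
    filter_upwards [mem_nhdsWithin_of_mem_nhds (hU.mem_nhds hxU), self_mem_nhdsWithin] with y h1 h2
    refine (hclose (hU.inter hV) (fun z hz => ?_) y ⟨h1, h2⟩).trans_lt (half_lt_self hε)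
    exact (hUV ⟨hz.1.1, hz.1.2, hz.2⟩ : _).le
  refine ⟨g, hg, fun x => ?_, fun x => ?_⟩
  · rw [← continuousWithinAt_Ioi_iff_Ici]
    exact main isOpen_Ioi (hg x)
  · obtain ⟨l, hl⟩ := hf.exists_tendsto_left hD x
    exact ⟨l, main isOpen_Iio hl⟩

theorem isCadlag_comp_val {g : ℝ → ℝ} (hr : ∀ x, ContinuousWithinAt g (Set.Ici x) x)
    (hl : ∀ x, ∃ l, Filter.Tendsto g (𝓝[<] x) (𝓝 l)) :
    IsCadlag fun t : unitInterval => g t := by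
  intro t
  refine ⟨(hr t).comp continuous_subtype_val.continuousWithinAt fun s hs => hs, ?_⟩
  obtain ⟨l, h⟩ := hl t
  exact ⟨l, h.comp (continuous_subtype_val.continuousWithinAt.tendsto_nhdsWithin fun s hs => hs)⟩

/-! ### Moment bounds on the dyadic grids -/

/-- The path extended from `[0,1]` to `ℝ` by constants. -/
noncomputable def extendPath (x : unitInterval → ℝ) : ℝ → ℝ :=
  Set.IccExtend zero_le_one x

theorem minIncrement_nonneg (f : ℝ → ℝ) (s t u : ℝ) : 0 ≤ minIncrement f s t u :=
  le_min (abs_nonneg _) (abs_nonneg _)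

theorem minIncrement_extendPath_eq_zero (x : unitInterval → ℝ) {s t u : ℝ} (hst : s ≤ t)
    (htu : t ≤ u) (h : t ≤ 0 ∨ 1 ≤ t) : minIncrement (extendPath x) s t u = 0 := by
  unfold minIncrement extendPath
  rcases h with h | h
  · rw [Set.IccExtend_of_le_left _ _ h, Set.IccExtend_of_le_left _ _ (hst.trans h)]
    simp
  · rw [Set.IccExtend_of_right_le _ _ h, Set.IccExtend_of_right_le _ _ (h.trans htu)]
    simp

section PathEnergy

variable {Ω : Type*} [MeasurableSpace Ω] {P : Measure Ω} {X : unitInterval → Ω → ℝ}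

theorem measurable_extendPath (hX : ∀ t, Measurable (X t)) (x : ℝ) :
    Measurable fun ω => extendPath (fun t => X t ω) x :=
  hX _

theorem measurable_minIncrement_extendPath (hX : ∀ t, Measurable (X t)) (s t u : ℝ) :
    Measurable fun ω => minIncrement (extendPath fun t => X t ω) s t u :=
  (((measurable_extendPath hX t).sub (measurable_extendPath hX s)).abs).min
    (((measurable_extendPath hX t).sub (measurable_extendPath hX u)).abs)

/-- When `t` is inside `(0, 1)`, projecting `s` and `u` to `[0, 1]` keeps the strict order and only
shortens the span; otherwise the increment vanishes. -/
theorem lintegral_minIncrement_rpow_le {p r C : ℝ} (hp : 0 < p) (hr : 0 < r)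
    (hmin : ∀ s t u : unitInterval, s < t → t < u →
      ∫⁻ ω, ENNReal.ofReal (min (|X t ω - X s ω| ^ p) (|X t ω - X u ω| ^ p)) ∂P
        ≤ ENNReal.ofReal (C * |(u : ℝ) - (s : ℝ)| ^ (1 + r)))
    {s t u : ℝ} (hst : s < t) (htu : t < u) :
    ∫⁻ ω, ENNReal.ofReal (minIncrement (extendPath fun t => X t ω) s t u ^ p) ∂P
      ≤ ENNReal.ofReal (|C| * (u - s) ^ (1 + r)) := by
  by_cases h : t ≤ 0 ∨ 1 ≤ t
  · simp [minIncrement_extendPath_eq_zero _ hst.le htu.le h, Real.zero_rpow hp.ne']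
  push Not at h
  have hproj : ∀ y, ((Set.projIcc (0 : ℝ) 1 zero_le_one y : unitInterval) : ℝ)
      = max 0 (min 1 y) := fun y => rfl
  have h1 : Set.projIcc (0 : ℝ) 1 zero_le_one s < Set.projIcc 0 1 zero_le_one t := by
    rw [← Subtype.coe_lt_coe, hproj, hproj, min_eq_right h.2.le, max_eq_right h.1.le]
    exact max_lt h.1 ((min_le_right _ _).trans_lt hst)
  have h2 : Set.projIcc (0 : ℝ) 1 zero_le_one t < Set.projIcc 0 1 zero_le_one u := by
    rw [← Subtype.coe_lt_coe, hproj, hproj, min_eq_right h.2.le, max_eq_right h.1.le]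
    exact lt_max_of_lt_right (lt_min h.2 htu)
  have hmono : MonotoneOn (fun y : ℝ => y ^ p) (Set.Ici 0) :=
    Real.monotoneOn_rpow_Ici_of_exponent_nonneg hp.le
  calc _ = ∫⁻ ω, ENNReal.ofReal (min
        (|X (Set.projIcc 0 1 zero_le_one t) ω - X (Set.projIcc 0 1 zero_le_one s) ω| ^ p)
        (|X (Set.projIcc 0 1 zero_le_one t) ω - X (Set.projIcc 0 1 zero_le_one u) ω| ^ p)) ∂P := by
        refine lintegral_congr fun ω => ?_
        congr 1
        exact hmono.map_min (Set.mem_Ici.2 (abs_nonneg _)) (Set.mem_Ici.2 (abs_nonneg _))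
    _ ≤ _ := hmin _ _ _ h1 h2
    _ ≤ _ := by
        refine ENNReal.ofReal_le_ofReal (mul_le_mul (le_abs_self C) ?_ (by positivity)
          (abs_nonneg _))
        refine Real.rpow_le_rpow (abs_nonneg _) ?_ (by positivity)
        rw [abs_of_nonneg (sub_nonneg.2 (Subtype.coe_le_coe.2 (h1.trans h2).le)), hproj, hproj]
        have : max 0 (min 1 u) ≤ u := max_le (by linarith) (min_le_right _ _)
        have : min 1 s ≤ max 0 (min 1 s) := le_max_right _ _
        rw [min_eq_right (by linarith : s ≤ 1)] at this ⊢
        linarith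

/-- The weighted sum of the two-sided increments of a path over the dyadic grid of level `n`. -/
noncomputable def gridEnergy (p q : ℝ) (n : ℕ) (x : unitInterval → ℝ) : ENNReal :=
  ENNReal.ofReal ((q ^ n)⁻¹) * ∑ k ∈ Finset.range (2 ^ n),
    ENNReal.ofReal (minIncrement (extendPath x) (k / 2 ^ n) ((k + 1) / 2 ^ n)
      ((k + 2) / 2 ^ n) ^ p)

theorem measurable_gridEnergy (hX : ∀ t, Measurable (X t)) (p q : ℝ) (n : ℕ) :
    Measurable fun ω => gridEnergy p q n fun t => X t ω := by
  unfold gridEnergy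
  refine Measurable.const_mul (Finset.measurable_fun_sum _ fun k _ => ?_) _
  exact ((measurable_minIncrement_extendPath hX _ _ _).pow_const p).ennreal_ofReal

/-- The unweighted sum has mean of order `2 ^ (-n r)`. The weight with `q = 2 ^ (-r / 2)` spends
half of this decay and leaves `q ^ n`. -/
theorem lintegral_gridEnergy_le (hX : ∀ t, Measurable (X t)) {p r C : ℝ} (hp : 0 < p)
    (hr : 0 < r)
    (hmin : ∀ s t u : unitInterval, s < t → t < u →
      ∫⁻ ω, ENNReal.ofReal (min (|X t ω - X s ω| ^ p) (|X t ω - X u ω| ^ p)) ∂P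
        ≤ ENNReal.ofReal (C * |(u : ℝ) - (s : ℝ)| ^ (1 + r))) (n : ℕ) :
    ∫⁻ ω, gridEnergy p (2 ^ (-r / 2)) n (fun t => X t ω) ∂P
      ≤ ENNReal.ofReal (|C| * 2 ^ (1 + r) * (2 ^ (-r / 2)) ^ n) := by
  have hmeas := fun k : ℕ => ((measurable_minIncrement_extendPath hX (k / 2 ^ n)
    ((k + 1) / 2 ^ n) ((k + 2) / 2 ^ n)).pow_const p).ennreal_ofReal
  have hpow : (0 : ℝ) < 2 ^ n := by positivity
  unfold gridEnergy
  rw [lintegral_const_mul _ (Finset.measurable_fun_sum _ fun k _ => hmeas k),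
    lintegral_finsetSum _ fun k _ => hmeas k]
  have hterm : ∀ k ∈ Finset.range (2 ^ n),
      ∫⁻ ω, ENNReal.ofReal (minIncrement (extendPath fun t => X t ω) (k / 2 ^ n)
        ((k + 1) / 2 ^ n) ((k + 2) / 2 ^ n) ^ p) ∂P
      ≤ ENNReal.ofReal (|C| * (2 / 2 ^ n) ^ (1 + r)) := by
    intro k _
    refine (lintegral_minIncrement_rpow_le hp hr hmin
      (div_lt_div_of_pos_right (by linarith) hpow)
      (div_lt_div_of_pos_right (by linarith) hpow)).trans_eq ?_
    rw [← sub_div, add_sub_cancel_left]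
  refine (mul_le_mul_right (Finset.sum_le_sum hterm) _).trans_eq ?_
  rw [Finset.sum_const, Finset.card_range, nsmul_eq_mul, ← ENNReal.ofReal_natCast,
    ← ENNReal.ofReal_mul (by positivity), ← ENNReal.ofReal_mul (by positivity)]
  congr 1
  have hscale : ((2 : ℝ) ^ n) ^ (1 + r) * ((2 ^ (-r / 2)) ^ n * (2 ^ (-r / 2)) ^ n) = 2 ^ n := by
    rw [← Real.rpow_natCast 2 n, ← Real.rpow_natCast (2 ^ (-r / 2)) n,
      ← Real.rpow_mul zero_le_two, ← Real.rpow_mul zero_le_two,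
      ← Real.rpow_add zero_lt_two, ← Real.rpow_add zero_lt_two]
    congr 1
    ring
  rw [Real.div_rpow zero_le_two hpow.le]
  push_cast
  have hq' : (0 : ℝ) < (2 ^ (-r / 2)) ^ n := by positivity
  have hw : (0 : ℝ) < (2 ^ n) ^ (1 + r) := by positivity
  generalize ((2 : ℝ) ^ n) ^ (1 + r) = w at *
  generalize ((2 : ℝ) ^ (-r / 2)) ^ n = v at *
  rw [← hscale]
  field_simp

theorem ae_tsum_gridEnergy_ne_top (hX : ∀ t, Measurable (X t)) {p r C : ℝ} (hp : 0 < p)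
    (hr : 0 < r)
    (hmin : ∀ s t u : unitInterval, s < t → t < u →
      ∫⁻ ω, ENNReal.ofReal (min (|X t ω - X s ω| ^ p) (|X t ω - X u ω| ^ p)) ∂P
        ≤ ENNReal.ofReal (C * |(u : ℝ) - (s : ℝ)| ^ (1 + r))) :
    ∀ᵐ ω ∂P, ∑' n, gridEnergy p (2 ^ (-r / 2)) n (fun t => X t ω) ≠ ⊤ := by
  have hmeas := measurable_gridEnergy hX p (2 ^ (-r / 2))
  have hq : (2 : ℝ) ^ (-r / 2) < 1 := Real.rpow_lt_one_of_one_lt_of_neg one_lt_two (by linarith)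
  have hfin : ∫⁻ ω, ∑' n, gridEnergy p (2 ^ (-r / 2)) n (fun t => X t ω) ∂P ≠ ⊤ := by
    rw [lintegral_tsum fun n => (hmeas n).aemeasurable]
    refine ne_top_of_le_ne_top ?_
      (ENNReal.tsum_le_tsum fun n => lintegral_gridEnergy_le hX hp hr hmin n)
    exact ((summable_geometric_of_lt_one (by positivity) hq).mul_left _).tsum_ofReal_ne_top
  filter_upwards [ae_lt_top (Measurable.tsum hmeas) hfin] with ω h using h.ne

end PathEnergy

/-- The energies tend to zero, so are eventually at most `1`; each increment at level `n` is then at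
most `q ^ (n / p)`. -/
theorem hasSmallMinIncrements_of_tsum_gridEnergy_ne_top {p q : ℝ} (hp : 0 < p) (hq : 0 < q)
    (hq1 : q < 1) {x : unitInterval → ℝ} (h : ∑' n, gridEnergy p q n x ≠ ⊤) :
    HasSmallMinIncrements (extendPath x) dyadics := by
  have hq' : q ^ p⁻¹ < 1 := Real.rpow_lt_one hq.le hq1 (by positivity)
  refine hasSmallMinIncrements_dyadics (a := fun n => (q ^ p⁻¹) ^ n) (fun n => by positivity)
    (summable_geometric_of_lt_one (by positivity) hq') ?_
  have hev := (ENNReal.tendsto_atTop_zero_of_tsum_ne_top h).eventually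
    (ge_mem_nhds (zero_lt_one (α := ENNReal)))
  filter_upwards [hev] with n hn k
  have hpow : (0 : ℝ) < 2 ^ n := by positivity
  by_cases hk : 0 ≤ k ∧ k < 2 ^ n
  · lift k to ℕ using hk.1
    have hk' : k ∈ Finset.range (2 ^ n) := by
      rw [Finset.mem_range]; exact_mod_cast hk.2
    set m := minIncrement (extendPath x) (k / 2 ^ n) ((k + 1) / 2 ^ n) ((k + 2) / 2 ^ n) with hm
    have hm0 : 0 ≤ m := minIncrement_nonneg _ _ _ _
    have h1 : ENNReal.ofReal ((q ^ n)⁻¹ * m ^ p) ≤ 1 := by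
      rw [ENNReal.ofReal_mul (by positivity)]
      refine le_trans (mul_le_mul_right ?_ _) hn
      exact Finset.single_le_sum (f := fun k : ℕ => ENNReal.ofReal (minIncrement (extendPath x)
        (k / 2 ^ n) ((k + 1) / 2 ^ n) ((k + 2) / 2 ^ n) ^ p)) (fun _ _ => zero_le) hk'
    rw [ENNReal.ofReal_le_one, inv_mul_le_one₀ (by positivity)] at h1
    have h2 := Real.rpow_le_rpow (by positivity) h1 (by positivity : 0 ≤ p⁻¹)
    rw [Real.rpow_rpow_inv hm0 hp.ne'] at h2
    refine h2.trans_eq ?_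
    rw [← Real.rpow_natCast, ← Real.rpow_natCast, ← Real.rpow_mul hq.le, ← Real.rpow_mul hq.le,
      mul_comm]
  · rw [minIncrement_extendPath_eq_zero]
    · positivity
    · exact div_le_div_of_nonneg_right (by linarith) hpow.le
    · exact div_le_div_of_nonneg_right (by linarith) hpow.le
    · by_cases h0 : 0 ≤ k
      · right
        have : (2 : ℤ) ^ n ≤ k + 1 := by have := not_and.1 hk h0; omega
        rw [le_div_iff₀ hpow, one_mul]
        exact_mod_cast this
      · left
        have : k + 1 ≤ 0 := by omega
        refine div_nonpos_of_nonpos_of_nonneg ?_ hpow.le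
        exact_mod_cast this

/-! ### Construction of the modification -/

theorem corollary2 {Ω : Type*} [MeasurableSpace Ω] (P : Measure Ω) [IsProbabilityMeasure P]
    (X : unitInterval → Ω → ℝ) (hX : ∀ t, Measurable (X t))
    (hcont : IsStochasticallyContinuous P X)
    (p r C : ℝ) (hp : 1 < p) (hr : 0 < r)
    (hmin : ∀ s t u : unitInterval, s < t → t < u →
      ∫⁻ ω, ENNReal.ofReal (min (|X t ω - X s ω| ^ p) (|X t ω - X u ω| ^ p)) ∂P
        ≤ ENNReal.ofReal (C * |(u : ℝ) - (s : ℝ)| ^ (1 + r)))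
    (hzero : ∀ t : unitInterval, 0 < t → t < 1 →
      ∫⁻ ω, ENNReal.ofReal (|X 0 ω - X t ω| ^ p) ∂P ≤ ENNReal.ofReal (C * (t : ℝ) ^ r))
    (hone : ∀ t : unitInterval, 0 < t → t < 1 →
      ∫⁻ ω, ENNReal.ofReal (|X 1 ω - X t ω| ^ p) ∂P ≤ ENNReal.ofReal (C * |1 - (t : ℝ)| ^ r)) :
    ∃ Y : unitInterval → Ω → ℝ,
      (∀ t, Measurable (Y t)) ∧ IsModification P X Y ∧ ∀ ω, IsCadlag (fun t => Y t ω) := by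
  classical
  have hp0 : 0 < p := by linarith
  have hq1 : (2 : ℝ) ^ (-r / 2) < 1 :=
    Real.rpow_lt_one_of_one_lt_of_neg one_lt_two (by linarith)
  set G : Set Ω := {ω | ∑' n, gridEnergy p (2 ^ (-r / 2)) n (fun t => X t ω) ≠ ⊤} with hG
  have hGmeas : MeasurableSet G :=
    (Measurable.tsum (measurable_gridEnergy hX p (2 ^ (-r / 2)))
      (measurableSet_singleton ⊤)).compl
  have hGae : ∀ᵐ ω ∂P, ω ∈ G := ae_tsum_gridEnergy_ne_top hX hp0 hr hmin
  choose! Z hlim hright hleft using fun ω (hω : ω ∈ G) =>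
    (hasSmallMinIncrements_of_tsum_gridEnergy_ne_top hp0 (by positivity) hq1 hω).exists_cadlag
      dense_dyadics
  have hseq : ∀ t : unitInterval, ∃ d : ℕ → ℝ,
      Filter.Tendsto d Filter.atTop (𝓝[Set.Ioi (t : ℝ) ∩ dyadics] t) := fun t =>
    have := dense_dyadics.nhdsWithin_inter_Ioi_neBot t
    Filter.exists_seq_tendsto _
  have hconv : ∀ (t : unitInterval) (d : ℕ → ℝ),
      Filter.Tendsto d Filter.atTop (𝓝[Set.Ioi (t : ℝ) ∩ dyadics] t) → ∀ ω,
      Filter.Tendsto (fun n => G.indicator (fun ω => extendPath (fun s => X s ω) (d n)) ω)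
        Filter.atTop (𝓝 (G.indicator (fun ω => Z ω t) ω)) := by
    intro t d hd ω
    by_cases hω : ω ∈ G
    · simpa only [Set.indicator_of_mem hω, Function.comp_def] using (hlim ω hω t).comp hd
    · simpa only [Set.indicator_of_notMem hω] using tendsto_const_nhds
  refine ⟨fun t => G.indicator fun ω => Z ω t, fun t => ?_, fun t => ?_, fun ω => ?_⟩
  · obtain ⟨d, hd⟩ := hseq t
    exact measurable_of_tendsto_metrizable
      (fun n => (measurable_extendPath hX (d n)).indicator hGmeas)
      (tendsto_pi_nhds.2 (hconv t d hd))
  · obtain ⟨d, hd⟩ := hseq t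
    -- The projection matters at `t = 1`, where the `d n` exceed `1` and are sent back to `1`.
    have hd' : Filter.Tendsto (fun n => Set.projIcc (0 : ℝ) 1 zero_le_one (d n)) Filter.atTop
        (𝓝 t) := by
      have := (continuous_projIcc (h := zero_le_one (α := ℝ))).tendsto (t : ℝ)
      rw [Set.projIcc_val] at this
      exact this.comp (tendsto_nhds_of_tendsto_nhdsWithin hd)
    have h1 : TendstoInMeasure P (fun n => X (Set.projIcc 0 1 zero_le_one (d n)))
        Filter.atTop (X t) := fun ε hε => (hcont t ε hε).comp hd'
    have h2 : TendstoInMeasure P (fun n => X (Set.projIcc 0 1 zero_le_one (d n)))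
        Filter.atTop (G.indicator fun ω => Z ω t) := by
      refine tendstoInMeasure_of_tendsto_ae (fun n => (hX _).aestronglyMeasurable) ?_
      filter_upwards [hGae] with ω hω
      have := hconv t d hd ω
      simp only [Set.indicator_of_mem hω] at this ⊢
      exact this
    -- The same sequence tends to `X t` by stochastic continuity and to the right limit by almost
    -- sure convergence.
    exact tendstoInMeasure_ae_unique h1 h2
  · by_cases hω : ω ∈ G
    · simp only [Set.indicator_of_mem hω]
      exact isCadlag_comp_val (hright ω hω) (hleft ω hω)
    · simp only [Set.indicator_of_notMem hω]
      exact fun t => ⟨continuousWithinAt_const, 0, tendsto_const_nhds⟩
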